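/- All graphs are finite and undirected, and parallel edges and self-loops are allowed; in the degree $\deg v$ of a vertex, parallel edges are counted separately and each self-loop is counted twice. For a graph $G=(V,E)$, a function $w:V\to\mathbb{Z}_{>0}$ is called a legal weighting if $w(v)\ge \deg v$ for all $v\in V$. For $0<\beta<1$ and complex vertex activities $(z_v)_{v\in V}$ let $$Z_w(G)=\sum_{\sigma\in\{+,-\}^V}\beta^{d(\sigma)}\prod_{v:\,\sigma(v)=+}z_v^{w(v)},\qquad Z(G)=\sum_{\sigma\in\{+,-\}^V}\beta^{d(\sigma)}\prod_{v:\,\sigma(v)=+}z_v,$$ where $d(\sigma)$ is the number of edges whose two ends have different spins in $\sigma$, and let $\mathcal{D}_G=\sum_{v\in V}z_v\frac{\partial}{\partial z_v}$. Theorem. Let $G$ be a connected graph (in particular, with at least one vertex). Then $G$ has the weighted strict Gauss–Lucas property: for every legal weighting $w$, every $0<\beta<1$ and all complex activities with $|z_v|\ge 1$ for all $v\in V$, one has $\mathcal{D}_G Z_w(G)\ne 0$ at $(z_v)_{v\in V}$. Hence $G$ also has the strict Gauss–Lucas property: for every $0<\beta<1$ and all complex activities with $|z_v|\ge 1$ for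 all $v\in V$, one has $\mathcal{D}_G Z(G)\ne 0$ at $(z_v)_{v\in V}$. -/

import Mathlib

open scoped Graph

namespace Graph

/-- A multigraph is connected if it has a vertex and any two of its vertices are joined by a
finite sequence of consecutive adjacent vertices. -/
def Connected {α β : Type*} (G : Graph α β) : Prop :=
  V(G).Nonempty ∧ ∀ u ∈ V(G), ∀ v ∈ V(G), Relation.ReflTransGen G.Adj u v

/-- The degree of a vertex of a finite multigraph: parallel edges are counted separately, and each
self-loop is counted twice. -/
noncomputable def degree {α β : Type*} (G : Graph α β) (v : α) : ℕ :=
  {e | G.IsNonloopAt e v}.ncard + 2 * {e | G.IsLoopAt e v}.ncard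

/-- Vertex weights are legal if they are positive integers and each of them is at least the degree
of the vertex. -/
def IsLegalWeight {α β : Type*} (G : Graph α β) (w : V(G) → ℕ) : Prop :=
  ∀ v : V(G), 0 < w v ∧ G.degree v ≤ w v

/-- The number `d(σ)` of edges whose ends have different spins in the configuration `σ`
(`true` is the spin `+`, `false` is the spin `-`). -/
noncomputable def disagreements {α β : Type*} (G : Graph α β) (σ : V(G) → Bool) : ℕ :=
  {e | ∃ x y : V(G), G.IsLink e x y ∧ σ x ≠ σ y}.ncard

open Classical in
/-- The weighted partition function `Z_w(G) = ∑_σ b ^ d(σ) ∏_{v : σ(v) = +} z_v ^ w(v)` of the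
Ising model with edge potential `b`, as a polynomial in the vertex activities `z_v`. -/
noncomputable def weightedIsingPartition {α β : Type*} (G : Graph α β) [Fintype V(G)]
    (w : V(G) → ℕ) (b : ℝ) : MvPolynomial V(G) ℂ :=
  ∑ σ : V(G) → Bool, MvPolynomial.C ((b : ℂ) ^ G.disagreements σ) *
    ∏ v ∈ Finset.univ.filter (fun v => σ v = true), MvPolynomial.X v ^ w v

open Classical in
/-- The partition function `Z(G) = ∑_σ b ^ d(σ) ∏_{v : σ(v) = +} z_v` of the Ising model with edge
potential `b`, as a polynomial in the vertex activities `z_v`. -/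
noncomputable def isingPartition {α β : Type*} (G : Graph α β) [Fintype V(G)]
    (b : ℝ) : MvPolynomial V(G) ℂ :=
  ∑ σ : V(G) → Bool, MvPolynomial.C ((b : ℂ) ^ G.disagreements σ) *
    ∏ v ∈ Finset.univ.filter (fun v => σ v = true), MvPolynomial.X v

/-- The linear differential operator `D_G = ∑_v z_v ∂/∂z_v`. -/
noncomputable def activityDeriv {α β : Type*} (G : Graph α β) [Fintype V(G)]
    (p : MvPolynomial V(G) ℂ) : MvPolynomial V(G) ℂ :=
  ∑ v : V(G), MvPolynomial.X v * MvPolynomial.pderiv v p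

/-- The strict Gauss-Lucas property. -/
def StrictGaussLucas {α β : Type*} (G : Graph α β) [Fintype V(G)] : Prop :=
  ∀ b : ℝ, 0 < b → b < 1 → ∀ z : V(G) → ℂ, (∀ v, 1 ≤ ‖z v‖) →
    MvPolynomial.eval z (G.activityDeriv (G.isingPartition b)) ≠ 0

/-- The weighted strict Gauss-Lucas property. -/
def WeightedStrictGaussLucas {α β : Type*} (G : Graph α β) [Fintype V(G)] : Prop :=
  ∀ w : V(G) → ℕ, G.IsLegalWeight w → ∀ b : ℝ, 0 < b → b < 1 →
    ∀ z : V(G) → ℂ, (∀ v, 1 ≤ ‖z v‖) →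
      MvPolynomial.eval z (G.activityDeriv (G.weightedIsingPartition w b)) ≠ 0

end Graph

/-! Encode the graph by couplings `c i j = b ^ m`, with `m` the number of edges joining `i` and `j`,
and replace `z i` by `z i ^ w i`, which still has norm at least 1. Let `P v` be the part of the
partition function `Z` where `v` has spin `+` (`plusPartition`). The derivative to be bounded away
from zero is then `∑ w v * P v`.

The engine is the Lee–Yang type comparison `norm_pairPartition_le`: the part with `v` at `-` is no
larger in norm than `P v`. If `Z ≠ 0`, every `P v / Z` therefore has real part at least 1/2, so a
positive combination cannot vanish. If `Z = 0`, divide by a fixed `P v` instead: connectedness gives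
`P v ≠ 0` (`pairPartition_ne_zero`), and a perturbation of `z v` shows that each `P u / P v` has
nonnegative real part, while the term `u = v` is strictly positive. -/

section Ising

open Finset ComplexConjugate

/-! ### Two-field partition functions and their expansion at a vertex -/

section PairPartition

variable {ι : Type*} [DecidableEq ι]

/-- The two-field partition function of the Ising model with couplings `c` on the vertex set `S`:
a vertex of spin `+` contributes `x i` and a vertex of spin `-` contributes `y i`. -/
noncomputable def pairPartition (c : ι → ι → ℝ) (S : Finset ι) (x y : ι → ℂ) : ℂ :=
  ∑ T ∈ S.powerset, (∏ i ∈ T, ∏ j ∈ S \ T, (c i j : ℂ)) * ((∏ i ∈ T, x i) * ∏ i ∈ S \ T, y i)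

lemma pairPartition_empty (c : ι → ι → ℝ) (x y : ι → ℂ) : pairPartition c ∅ x y = 1 := by
  simp [pairPartition]

lemma pairPartition_comm {c : ι → ι → ℝ} (hc : ∀ i j, c i j = c j i) (S : Finset ι)
    (x y : ι → ℂ) : pairPartition c S x y = pairPartition c S y x := by
  refine sum_nbij' (fun T => S \ T) (fun T => S \ T) ?_ ?_ ?_ ?_ ?_
  · intro T _; simp
  · intro T _; simp
  · intro T hT; simpa using hT
  · intro T hT; simpa using hT
  · intro T hT
    have h : S \ (S \ T) = T := by simpa using hT
    rw [h, Finset.prod_comm, mul_comm (∏ i ∈ T, x i)]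
    simp_rw [fun i j => hc i j]

lemma pairPartition_congr {c : ι → ι → ℝ} {S : Finset ι} {x y x' y' : ι → ℂ}
    (hx : ∀ i ∈ S, x i = x' i) (hy : ∀ i ∈ S, y i = y' i) :
    pairPartition c S x y = pairPartition c S x' y' := by
  refine sum_congr rfl fun T hT => ?_
  rw [prod_congr rfl fun i hi => hx i (mem_powerset.1 hT hi),
    prod_congr rfl fun i hi => hy i (mem_sdiff.1 hi).1]

lemma pairPartition_mul (c : ι → ι → ℝ) (S : Finset ι) (u x y : ι → ℂ) :
    pairPartition c S (fun i => u i * x i) (fun i => u i * y i) =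
      (∏ i ∈ S, u i) * pairPartition c S x y := by
  rw [pairPartition, pairPartition, mul_sum]
  refine sum_congr rfl fun T hT => ?_
  rw [prod_mul_distrib, prod_mul_distrib, ← prod_sdiff (mem_powerset.1 hT)]
  ring

lemma conj_pairPartition (c : ι → ι → ℝ) (S : Finset ι) (x y : ι → ℂ) :
    conj (pairPartition c S x y) =
      pairPartition c S (fun i => conj (x i)) (fun i => conj (y i)) := by
  simp [pairPartition, map_sum, map_prod]

lemma prod_coupling_insert_right (c : ι → ι → ℝ) {S T : Finset ι} {v : ι} (hv : v ∉ S)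
    (hT : T ⊆ S) (x y : ι → ℂ) :
    (∏ i ∈ T, ∏ j ∈ insert v S \ T, (c i j : ℂ)) *
        ((∏ i ∈ T, x i) * ∏ i ∈ insert v S \ T, y i) =
      y v * ((∏ i ∈ T, ∏ j ∈ S \ T, (c i j : ℂ)) *
        ((∏ i ∈ T, (c i v * x i)) * ∏ i ∈ S \ T, y i)) := by
  have hvT : v ∉ T := fun h => hv (hT h)
  have hvS : v ∉ S \ T := fun h => hv (mem_sdiff.1 h).1
  rw [insert_sdiff_of_notMem _ hvT, prod_insert hvS,
    prod_congr rfl fun i _ => prod_insert (f := fun j => (c i j : ℂ)) hvS, prod_mul_distrib,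
    prod_mul_distrib]
  ring

lemma prod_coupling_insert_left (c : ι → ι → ℝ) {S T : Finset ι} {v : ι} (hv : v ∉ S)
    (hT : T ⊆ S) (x y : ι → ℂ) :
    (∏ i ∈ insert v T, ∏ j ∈ insert v S \ insert v T, (c i j : ℂ)) *
        ((∏ i ∈ insert v T, x i) * ∏ i ∈ insert v S \ insert v T, y i) =
      x v * ((∏ i ∈ T, ∏ j ∈ S \ T, (c i j : ℂ)) *
        ((∏ i ∈ T, x i) * ∏ i ∈ S \ T, (c v i * y i))) := by
  have hvT : v ∉ T := fun h => hv (hT h)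
  have h : insert v S \ insert v T = S \ T := by
    ext i; simp only [mem_sdiff, mem_insert]; grind
  rw [h, prod_insert hvT, prod_insert hvT, prod_mul_distrib]
  ring

lemma pairPartition_insert (c : ι → ι → ℝ) {S : Finset ι} {v : ι} (hv : v ∉ S) (x y : ι → ℂ) :
    pairPartition c (insert v S) x y =
      x v * pairPartition c S x (fun i => c v i * y i) +
      y v * pairPartition c S (fun i => c i v * x i) y := by
  rw [pairPartition, sum_powerset_insert hv, add_comm, pairPartition, pairPartition, mul_sum,
    mul_sum]
  exact congrArg₂ _
    (sum_congr rfl fun T hT => prod_coupling_insert_left c hv (mem_powerset.1 hT) x y)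
    (sum_congr rfl fun T hT => prod_coupling_insert_right c hv (mem_powerset.1 hT) x y)

lemma sum_powerset_insert_mem (c : ι → ι → ℝ) {S : Finset ι} {v : ι} (hv : v ∉ S) (x y : ι → ℂ) :
    ∑ T ∈ (insert v S).powerset, (if v ∈ T then
      (∏ i ∈ T, ∏ j ∈ insert v S \ T, (c i j : ℂ)) *
        ((∏ i ∈ T, x i) * ∏ i ∈ insert v S \ T, y i) else 0) =
      x v * pairPartition c S x (fun i => c v i * y i) := by
  rw [sum_powerset_insert hv, pairPartition, mul_sum, sum_eq_zero, zero_add]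
  · refine sum_congr rfl fun T hT => ?_
    rw [if_pos (mem_insert_self v T),
      prod_coupling_insert_left c hv (mem_powerset.1 hT) x y]
  · intro T hT
    exact if_neg fun h => hv (mem_powerset.1 hT h)

/-! ### Lee–Yang comparison and nonvanishing -/

/-- The factors `y i / conj (x i)` are unimodular; pulling them out turns `(a x, y)` into `(a conj
y, conj x)`, and spin flip followed by conjugation gives `(x, a y)`. -/
lemma norm_pairPartition_eq {c : ι → ι → ℝ} (hc : ∀ i j, c i j = c j i) (S : Finset ι)
    (a : ι → ℝ) {x y : ι → ℂ} (hx : ∀ i ∈ S, x i ≠ 0) (h : ∀ i ∈ S, ‖y i‖ = ‖x i‖) :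
    ‖pairPartition c S (fun i => a i * x i) y‖ = ‖pairPartition c S x (fun i => a i * y i)‖ := by
  have hy : ∀ i ∈ S, y i = y i / conj (x i) * conj (x i) := fun i hi => by
    rw [div_mul_cancel₀]; simpa using hx i hi
  have hx' : ∀ i ∈ S, a i * x i = y i / conj (x i) * (a i * conj (y i)) := fun i hi => by
    have h1 : conj (x i) ≠ 0 := by simpa using hx i hi
    have h2 : x i * conj (x i) = y i * conj (y i) := by
      rw [Complex.mul_conj', Complex.mul_conj', h i hi]
    rw [div_mul_eq_mul_div, eq_div_iff h1, mul_assoc, h2]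
    ring
  rw [pairPartition_congr hx' hy, pairPartition_mul, norm_mul, norm_prod,
    prod_eq_one, one_mul, pairPartition_comm hc S x, ← Complex.norm_conj (pairPartition c S _ x),
    conj_pairPartition]
  · simp
  · intro i hi
    rw [norm_div, Complex.norm_conj, h i hi, div_self]
    simpa using hx i hi

lemma norm_sq_add_conj_mul_sub (x y ζ : ℂ) (k : ℝ) :
    ‖x + k * conj y * ζ‖ ^ 2 - ‖y + k * conj x * ζ‖ ^ 2 =
      (‖x‖ ^ 2 - ‖y‖ ^ 2) * (1 - k ^ 2 * ‖ζ‖ ^ 2) := by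
  simp only [← Complex.normSq_eq_norm_sq, Complex.normSq_apply, Complex.add_re, Complex.add_im,
    Complex.mul_re, Complex.mul_im, Complex.conj_re, Complex.conj_im, Complex.ofReal_re,
    Complex.ofReal_im]
  ring

/-- Maximum modulus principle: embed `(x, y)` as the value at `ζ = 0` of a family that is affine in
`ζ` and satisfies `‖Y‖ = ‖X‖` on the unit circle, where the quotient of the two sides has norm 1. -/
lemma norm_pairPartition_le_of_ne_zero {c : ι → ι → ℝ} (hc : ∀ i j, c i j = c j i) (S : Finset ι)
    (a : ι → ℝ)
    (hne : ∀ x y : ι → ℂ, (∀ i ∈ S, x i ≠ 0) → (∀ i ∈ S, ‖y i‖ ≤ ‖x i‖) →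
      pairPartition c S x (fun i => a i * y i) ≠ 0)
    {x y : ι → ℂ} (hx : ∀ i ∈ S, x i ≠ 0) (h : ∀ i ∈ S, ‖y i‖ ≤ ‖x i‖) :
    ‖pairPartition c S (fun i => a i * x i) y‖ ≤ ‖pairPartition c S x (fun i => a i * y i)‖ := by
  classical
  -- The deformation is switched off where `‖y i‖ = ‖x i‖`: the norms already agree there, and `X ζ
  -- i` could otherwise vanish on the circle.
  set k : ι → ℝ := fun i => if ‖y i‖ < ‖x i‖ then 1 else 0 with hk
  set X : ℂ → ι → ℂ := fun ζ i => x i + k i * conj (y i) * ζ with hX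
  set Y : ℂ → ι → ℂ := fun ζ i => y i + k i * conj (x i) * ζ with hY
  have hX0 : ∀ ζ : ℂ, ‖ζ‖ ≤ 1 → ∀ i ∈ S, X ζ i ≠ 0 := by
    intro ζ hζ i hi h0
    simp only [hX, hk] at h0
    split_ifs at h0 with hlt
    · have h1 : ‖x i‖ = ‖y i‖ * ‖ζ‖ := by
        rw [eq_neg_of_add_eq_zero_left h0]; simp
      nlinarith [norm_nonneg (y i), norm_nonneg ζ]
    · exact hx i hi (by simpa using h0)
  have hXY : ∀ ζ : ℂ, ‖ζ‖ ≤ 1 → ∀ i ∈ S, ‖Y ζ i‖ ≤ ‖X ζ i‖ := by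
    intro ζ hζ i hi
    have h1 := norm_sq_add_conj_mul_sub (x i) (y i) ζ (k i)
    have h2 : k i ^ 2 ≤ 1 := by simp only [hk]; split_ifs <;> norm_num
    have h3 : ‖ζ‖ ^ 2 ≤ 1 := pow_le_one₀ (norm_nonneg _) hζ
    have h4 : ‖y i‖ ^ 2 ≤ ‖x i‖ ^ 2 := pow_le_pow_left₀ (norm_nonneg _) (h i hi) 2
    have h5 : k i ^ 2 * ‖ζ‖ ^ 2 ≤ 1 := mul_le_one₀ h2 (by positivity) h3
    refine le_of_sq_le_sq ?_ (norm_nonneg _)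
    have := mul_nonneg (sub_nonneg.2 h4) (sub_nonneg.2 h5)
    linarith
  have hXYeq : ∀ ζ : ℂ, ‖ζ‖ = 1 → ∀ i ∈ S, ‖Y ζ i‖ = ‖X ζ i‖ := by
    intro ζ hζ i hi
    have h1 := norm_sq_add_conj_mul_sub (x i) (y i) ζ (k i)
    have h2 : (‖x i‖ ^ 2 - ‖y i‖ ^ 2) * (1 - k i ^ 2 * ‖ζ‖ ^ 2) = 0 := by
      simp only [hk]
      split_ifs with hlt
      · simp [hζ]
      · rw [le_antisymm (h i hi) (not_lt.1 hlt)]; simp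
    refine (sq_eq_sq₀ (norm_nonneg _) (norm_nonneg _)).1 ?_
    linarith
  set A : ℂ → ℂ := fun ζ => pairPartition c S (X ζ) (fun i => a i * Y ζ i) with hA
  set B : ℂ → ℂ := fun ζ => pairPartition c S (fun i => a i * X ζ i) (Y ζ) with hB
  have hAne : ∀ ζ : ℂ, ‖ζ‖ ≤ 1 → A ζ ≠ 0 := fun ζ hζ => hne _ _ (hX0 ζ hζ) (hXY ζ hζ)
  have hAd : Differentiable ℂ A := by
    simp only [hA, hX, hY, pairPartition]; fun_prop
  have hBd : Differentiable ℂ B := by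
    simp only [hB, hX, hY, pairPartition]; fun_prop
  have hball : ∀ ζ ∈ closure (Metric.ball (0 : ℂ) 1), ‖ζ‖ ≤ 1 := fun ζ hζ => by
    rw [closure_ball _ one_ne_zero] at hζ; simpa using hζ
  have hd : DiffContOnCl ℂ (fun ζ => B ζ / A ζ) (Metric.ball 0 1) := by
    refine DifferentiableOn.diffContOnCl fun ζ hζ => ?_
    exact ((hBd ζ).div (hAd ζ) (hAne ζ (hball ζ hζ))).differentiableWithinAt
  have hmax := Complex.norm_le_of_forall_mem_frontier_norm_le (Metric.isBounded_ball) hd (C := 1)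
    (fun ζ hζ => by
      rw [frontier_ball _ one_ne_zero, mem_sphere_zero_iff_norm] at hζ
      rw [norm_div, norm_pairPartition_eq hc S a (hX0 ζ hζ.le) (hXYeq ζ hζ), div_self]
      simpa using hAne ζ hζ.le) (z := 0) (subset_closure (by simp))
  rw [norm_div, div_le_one (by simpa using hAne 0 (by simp))] at hmax
  simpa [hA, hB, hX, hY] using hmax

lemma norm_ofReal_mul_lt {a : ℝ} (ha0 : 0 < a) {x y : ℂ} (hx : x ≠ 0) (h : ‖y‖ ≤ ‖x‖)
    (hlt : a < 1) : ‖(a : ℂ) * y‖ < ‖x‖ := by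
  rw [norm_mul, Complex.norm_real, Real.norm_of_nonneg ha0.le]
  have := norm_pos_iff.2 hx
  nlinarith

lemma norm_ofReal_mul_le {a : ℝ} (ha0 : 0 < a) (ha1 : a ≤ 1) {x y : ℂ} (h : ‖y‖ ≤ ‖x‖) :
    ‖(a : ℂ) * y‖ ≤ ‖x‖ := by
  rw [norm_mul, Complex.norm_real, Real.norm_of_nonneg ha0.le]
  nlinarith [norm_nonneg y]

lemma mul_add_mul_ne_zero {x y A B : ℂ} (hA : A ≠ 0) (hBA : ‖B‖ ≤ ‖A‖) (hyx : ‖y‖ < ‖x‖) :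
    x * A + y * B ≠ 0 := by
  intro h
  have h1 : ‖x‖ * ‖A‖ = ‖y‖ * ‖B‖ := by
    rw [← norm_mul, ← norm_mul, eq_neg_of_add_eq_zero_left h, norm_neg]
  nlinarith [norm_pos_iff.2 hA, norm_nonneg y]

/-- Induction on `S`: expand at a vertex with strict inequality. Strict couplings damp `y` at all
remaining vertices, so nonvanishing on `S.erase v` holds for all fields there, as the comparison
requires. -/
lemma pairPartition_ne_zero_of_lt_one {c : ι → ι → ℝ} (hc : ∀ i j, c i j = c j i)
    (hc0 : ∀ i j, 0 < c i j) (hc1 : ∀ i j, c i j < 1) (S : Finset ι) {x y : ι → ℂ}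
    (hx : ∀ i ∈ S, x i ≠ 0) (h : ∀ i ∈ S, ‖y i‖ ≤ ‖x i‖)
    (hlt : S.Nonempty → ∃ i ∈ S, ‖y i‖ < ‖x i‖) : pairPartition c S x y ≠ 0 := by
  induction S using Finset.strongInduction generalizing x y with
  | H S ih =>
  rcases S.eq_empty_or_nonempty with rfl | hS
  · simp [pairPartition_empty]
  obtain ⟨v, hv, hvlt⟩ := hlt hS
  have hA : ∀ x y : ι → ℂ, (∀ i ∈ S.erase v, x i ≠ 0) → (∀ i ∈ S.erase v, ‖y i‖ ≤ ‖x i‖) →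
      pairPartition c (S.erase v) x (fun i => c v i * y i) ≠ 0 := by
    intro x y hx h
    refine ih _ (erase_ssubset hv) hx
      (fun i hi => norm_ofReal_mul_le (hc0 v i) (hc1 v i).le (h i hi)) ?_
    rintro ⟨i, hi⟩
    exact ⟨i, hi, norm_ofReal_mul_lt (hc0 v i) (hx i hi) (h i hi) (hc1 v i)⟩
  have hx' : ∀ i ∈ S.erase v, x i ≠ 0 := fun i hi => hx i (mem_of_mem_erase hi)
  have h' : ∀ i ∈ S.erase v, ‖y i‖ ≤ ‖x i‖ := fun i hi => h i (mem_of_mem_erase hi)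
  rw [← insert_erase hv, pairPartition_insert c (notMem_erase v S)]
  simp_rw [hc _ v]
  exact mul_add_mul_ne_zero (hA x y hx' h')
    (norm_pairPartition_le_of_ne_zero hc _ _ hA hx' h') hvlt

lemma norm_pairPartition_le {c : ι → ι → ℝ} (hc : ∀ i j, c i j = c j i)
    (hc0 : ∀ i j, 0 < c i j) (hc1 : ∀ i j, c i j ≤ 1) (S : Finset ι) (v : ι) {x y : ι → ℂ}
    (hx : ∀ i ∈ S, x i ≠ 0) (h : ∀ i ∈ S, ‖y i‖ ≤ ‖x i‖) :
    ‖pairPartition c S (fun i => c v i * x i) y‖ ≤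
      ‖pairPartition c S x (fun i => c v i * y i)‖ := by
  -- Scaling by `s < 1` makes all couplings strict; the non-strict inequality survives `s → 1`.
  let cs : ℝ → ι → ι → ℝ := fun s i j => s * c i j
  have key : ∀ s ∈ Set.Ioo (0 : ℝ) 1,
      ‖pairPartition (cs s) S (fun i => cs s v i * x i) y‖ ≤
        ‖pairPartition (cs s) S x (fun i => cs s v i * y i)‖ := by
    rintro s ⟨hs0, hs1⟩
    have hsc : ∀ i j, cs s i j = cs s j i := fun i j => by simp only [cs, hc i j]
    have hsc0 : ∀ i j, 0 < cs s i j := fun i j => mul_pos hs0 (hc0 i j)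
    have hsc1 : ∀ i j, cs s i j < 1 := fun i j => by
      have := hc0 i j; have := hc1 i j; simp only [cs]; nlinarith
    refine norm_pairPartition_le_of_ne_zero hsc S _ (fun x y hx h => ?_) hx h
    refine pairPartition_ne_zero_of_lt_one hsc hsc0 hsc1 S hx
      (fun i hi => norm_ofReal_mul_le (hsc0 v i) (hsc1 v i).le (h i hi)) ?_
    rintro ⟨i, hi⟩
    exact ⟨i, hi, norm_ofReal_mul_lt (hsc0 v i) (hx i hi) (h i hi) (hsc1 v i)⟩
  have h1 : Continuous fun s => ‖pairPartition (cs s) S (fun i => cs s v i * x i) y‖ := by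
    simp only [cs, pairPartition]; fun_prop
  have h2 : Continuous fun s => ‖pairPartition (cs s) S x (fun i => cs s v i * y i)‖ := by
    simp only [cs, pairPartition]; fun_prop
  have hmem : (1 : ℝ) ∈ closure (Set.Ioo (0 : ℝ) 1) := by
    rw [closure_Ioo zero_ne_one]; simp
  have h3 := (isClosed_le h1 h2).closure_subset_iff.2 key hmem
  rw [Set.mem_ofPred_eq] at h3
  simpa [cs] using h3

/-- The hypothesis `hlt` says that every nonempty `T` contains a strict vertex or is joined to its
complement by a strict coupling. It is inherited when a vertex is expanded away. -/
lemma pairPartition_ne_zero {c : ι → ι → ℝ} (hc : ∀ i j, c i j = c j i)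
    (hc0 : ∀ i j, 0 < c i j) (hc1 : ∀ i j, c i j ≤ 1) (S : Finset ι) {x y : ι → ℂ}
    (hx : ∀ i ∈ S, x i ≠ 0) (h : ∀ i ∈ S, ‖y i‖ ≤ ‖x i‖)
    (hlt : ∀ T ⊆ S, T.Nonempty →
      (∃ i ∈ T, ‖y i‖ < ‖x i‖) ∨ ∃ i ∈ T, ∃ j ∈ S \ T, c i j < 1) :
    pairPartition c S x y ≠ 0 := by
  induction S using Finset.strongInduction generalizing x y with
  | H S ih =>
  rcases S.eq_empty_or_nonempty with rfl | hS
  · simp [pairPartition_empty]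
  -- For `T = S` the complement is empty, so only the first alternative is possible.
  obtain ⟨v, hv, hvlt⟩ : ∃ i ∈ S, ‖y i‖ < ‖x i‖ := by simpa using hlt S subset_rfl hS
  have hx' : ∀ i ∈ S.erase v, x i ≠ 0 := fun i hi => hx i (mem_of_mem_erase hi)
  have h' : ∀ i ∈ S.erase v, ‖y i‖ ≤ ‖x i‖ := fun i hi => h i (mem_of_mem_erase hi)
  rw [← insert_erase hv, pairPartition_insert c (notMem_erase v S)]
  simp_rw [hc _ v]
  refine mul_add_mul_ne_zero (ih _ (erase_ssubset hv) hx'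
    (fun i hi => norm_ofReal_mul_le (hc0 v i) (hc1 v i) (h' i hi)) fun T hT hTne => ?_)
    (norm_pairPartition_le hc hc0 hc1 _ v hx' h') hvlt
  rcases hlt T (hT.trans (erase_subset v S)) hTne with ⟨i, hi, hi'⟩ | ⟨i, hi, j, hj, hij⟩
  · exact Or.inl ⟨i, hi, (norm_ofReal_mul_le (hc0 v i) (hc1 v i) le_rfl).trans_lt hi'⟩
  -- A strict coupling to the removed vertex damps `y i`, making `i` strict.
  · rcases eq_or_ne j v with rfl | hjv
    · exact Or.inl ⟨i, hi, norm_ofReal_mul_lt (hc0 j i) (hx' i (hT hi)) (h' i (hT hi))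
        (hc i j ▸ hij)⟩
    · refine Or.inr ⟨i, hi, j, ?_, hij⟩
      rw [Finset.mem_sdiff] at hj ⊢
      exact ⟨mem_erase.2 ⟨hjv, hj.1⟩, hj.2⟩

/-! ### The plus parts and their real-part bounds -/

lemma half_le_re_div_add {A B : ℂ} (hAB : A + B ≠ 0) (h : ‖B‖ ≤ ‖A‖) :
    1 / 2 ≤ (A / (A + B)).re := by
  have h1 : 0 < Complex.normSq (A + B) := Complex.normSq_pos.2 hAB
  have h2 : Complex.normSq B ≤ Complex.normSq A := by
    rw [Complex.normSq_eq_norm_sq, Complex.normSq_eq_norm_sq]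
    exact pow_le_pow_left₀ (norm_nonneg _) h 2
  rw [Complex.div_re, ← add_div, div_le_div_iff₀ two_pos h1]
  simp only [Complex.normSq_apply, Complex.add_re, Complex.add_im] at *
  nlinarith

variable [Fintype ι]

/-- The part of the partition function in which the vertex `v` has spin `+`. -/
noncomputable def plusPartition (c : ι → ι → ℝ) (z : ι → ℂ) (v : ι) : ℂ :=
  z v * pairPartition c (univ.erase v) z (fun i => c v i)

lemma pairPartition_univ_eq {c : ι → ι → ℝ} (hc : ∀ i j, c i j = c j i) (z : ι → ℂ) (v : ι) :
    pairPartition c univ z 1 = plusPartition c z v +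
      pairPartition c (univ.erase v) (fun i => c v i * z i) 1 := by
  rw [← insert_erase (mem_univ v), pairPartition_insert c (notMem_erase v univ), plusPartition]
  simp [hc _ v]

lemma half_le_re_plusPartition_div {c : ι → ι → ℝ} (hc : ∀ i j, c i j = c j i)
    (hc0 : ∀ i j, 0 < c i j) (hc1 : ∀ i j, c i j ≤ 1) {z : ι → ℂ} (hz : ∀ i, 1 ≤ ‖z i‖)
    (hZ : pairPartition c univ z 1 ≠ 0) (v : ι) :
    1 / 2 ≤ (plusPartition c z v / pairPartition c univ z 1).re := by
  rw [pairPartition_univ_eq hc z v] at hZ ⊢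
  refine half_le_re_div_add hZ ?_
  have h0 : ∀ i, z i ≠ 0 := fun i => norm_pos_iff.1 (zero_lt_one.trans_le (hz i))
  have := norm_pairPartition_le hc hc0 hc1 (univ.erase v) v (x := z) (y := 1)
    (fun i _ => h0 i) (fun i _ => by simpa using hz i)
  refine this.trans ?_
  rw [plusPartition, norm_mul]
  simpa using le_mul_of_one_le_left (norm_nonneg _) (hz v)

lemma plusPartition_ne_zero {c : ι → ι → ℝ} (hc : ∀ i j, c i j = c j i)
    (hc0 : ∀ i j, 0 < c i j) (hc1 : ∀ i j, c i j ≤ 1)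
    (hconn : ∀ T : Finset ι, T.Nonempty → T ≠ univ → ∃ i ∈ T, ∃ j ∉ T, c i j < 1)
    {z : ι → ℂ} (hz : ∀ i, 1 ≤ ‖z i‖) (v : ι) : plusPartition c z v ≠ 0 := by
  have h0 : ∀ i, z i ≠ 0 := fun i => norm_pos_iff.1 (zero_lt_one.trans_le (hz i))
  refine mul_ne_zero (h0 v) (pairPartition_ne_zero hc hc0 hc1 _ (fun i _ => h0 i)
    (fun i _ => ?_) fun T hT hTne => ?_)
  · rw [Complex.norm_real, Real.norm_of_nonneg (hc0 v i).le]
    exact (hc1 v i).trans (hz i)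
  · have hvT : v ∉ T := fun h => notMem_erase v univ (hT h)
    obtain ⟨i, hi, j, hj, hij⟩ := hconn T hTne (fun h => hvT (h ▸ mem_univ v))
    rcases eq_or_ne j v with rfl | hjv
    · refine Or.inl ⟨i, hi, ?_⟩
      rw [Complex.norm_real, Real.norm_of_nonneg (hc0 j i).le, hc j i]
      exact hij.trans_le (hz i)
    · exact Or.inr ⟨i, hi, j, by simp [hj, hjv], hij⟩

/-- Multiplying `z v` by `t > 1` moves `Z` from 0 to `(t - 1) * P v`, so the 1/2 bound applies;
clear the factor `t - 1` and let `t → 1`. -/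
lemma re_plusPartition_div_nonneg {c : ι → ι → ℝ} (hc : ∀ i j, c i j = c j i)
    (hc0 : ∀ i j, 0 < c i j) (hc1 : ∀ i j, c i j ≤ 1) {z : ι → ℂ} (hz : ∀ i, 1 ≤ ‖z i‖)
    (hZ : pairPartition c univ z 1 = 0) {u v : ι} (huv : u ≠ v) (hv : plusPartition c z v ≠ 0) :
    0 ≤ (plusPartition c z u / plusPartition c z v).re := by
  let zt : ℝ → ι → ℂ := fun t => Function.update z v (t * z v)
  have hZt : ∀ t : ℝ, pairPartition c univ (zt t) 1 = ((t - 1 : ℝ) : ℂ) * plusPartition c z v := by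
    intro t
    have h1 : ∀ i ∈ univ.erase v, zt t i = z i := fun i hi =>
      Function.update_of_ne (ne_of_mem_erase hi) _ _
    have h2 := pairPartition_univ_eq hc z v
    rw [hZ] at h2
    rw [pairPartition_univ_eq hc (zt t) v,
      pairPartition_congr (x' := fun i => c v i * z i) (y' := 1)
        (fun i hi => by rw [h1 i hi]) (fun _ _ => rfl), plusPartition,
      pairPartition_congr (x' := z) (y' := fun i => (c v i : ℂ)) h1 (fun _ _ => rfl),
      eq_neg_of_add_eq_zero_right h2.symm]
    simp only [plusPartition, zt, Function.update_self]
    push_cast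
    ring
  have key : ∀ t ∈ Set.Ioi (1 : ℝ), 0 ≤ (plusPartition c (zt t) u / plusPartition c z v).re := by
    intro t ht
    have ht0 : 0 < t - 1 := sub_pos.2 ht
    have hzt : ∀ i, 1 ≤ ‖zt t i‖ := by
      intro i
      rcases eq_or_ne i v with rfl | hi
      · simp only [zt, Function.update_self, norm_mul, Complex.norm_real]
        exact one_le_mul_of_one_le_of_one_le (ht.le.trans (le_abs_self t)) (hz i)
      · simpa only [zt, Function.update_of_ne hi] using hz i
    have hne : pairPartition c univ (zt t) 1 ≠ 0 := by
      rw [hZt]; exact mul_ne_zero (by exact_mod_cast ht0.ne') hv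
    have h1 := half_le_re_plusPartition_div hc hc0 hc1 hzt hne u
    rw [hZt, mul_comm, ← div_div, Complex.div_ofReal_re] at h1
    have h2 : 0 < (plusPartition c (zt t) u / plusPartition c z v).re / (t - 1) := by linarith
    exact ((div_pos_iff_of_pos_right ht0).1 h2).le
  have hcont : Continuous fun t => (plusPartition c (zt t) u / plusPartition c z v).re := by
    have hzc : ∀ i, Continuous fun t => zt t i := by
      intro i
      rcases eq_or_ne i v with rfl | hi
      · simp only [zt, Function.update_self]; fun_prop
      · simp only [zt, Function.update_of_ne hi]; fun_prop
    refine Complex.continuous_re.comp (Continuous.div_const ?_ _)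
    simp only [plusPartition, pairPartition]
    fun_prop
  have hmem : (1 : ℝ) ∈ closure (Set.Ioi (1 : ℝ)) := by
    rw [closure_Ioi]; exact Set.self_mem_Ici
  have h1 := (isClosed_le continuous_const hcont).closure_subset_iff.2 key hmem
  rw [Set.mem_ofPred_eq] at h1
  simpa [zt] using h1

theorem sum_mul_plusPartition_ne_zero [Nonempty ι] {c : ι → ι → ℝ} (hc : ∀ i j, c i j = c j i)
    (hc0 : ∀ i j, 0 < c i j) (hc1 : ∀ i j, c i j ≤ 1)
    (hconn : ∀ T : Finset ι, T.Nonempty → T ≠ univ → ∃ i ∈ T, ∃ j ∉ T, c i j < 1)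
    {z : ι → ℂ} (hz : ∀ i, 1 ≤ ‖z i‖) {w : ι → ℝ} (hw : ∀ i, 0 < w i) :
    ∑ v, (w v : ℂ) * plusPartition c z v ≠ 0 := by
  intro h0
  have hsum : ∀ q : ℂ, ∑ v, w v * (plusPartition c z v / q).re = 0 := by
    intro q
    have := congrArg (fun s => (s / q).re) h0
    simpa only [sum_div, Complex.re_sum, mul_div_assoc, Complex.re_ofReal_mul, zero_div,
      Complex.zero_re] using this
  obtain ⟨v⟩ := ‹Nonempty ι›
  by_cases hZ : pairPartition c univ z 1 = 0
  · have hv := plusPartition_ne_zero hc hc0 hc1 hconn hz v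
    refine (sum_pos' (fun u _ => mul_nonneg (hw u).le ?_) ⟨v, mem_univ v, ?_⟩).ne'
      (hsum (plusPartition c z v))
    · rcases eq_or_ne u v with rfl | huv
      · simp [div_self hv]
      · exact re_plusPartition_div_nonneg hc hc0 hc1 hz hZ huv hv
    · simpa [div_self hv] using hw v
  · refine (sum_pos (fun u _ => mul_pos (hw u) ?_) ⟨v, mem_univ v⟩).ne'
      (hsum (pairPartition c univ z 1))
    exact one_half_pos.trans_le (half_le_re_plusPartition_div hc hc0 hc1 hz hZ u)

end PairPartition

/-! ### From multigraphs to couplings -/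

namespace Graph

variable {α β : Type*} (G : Graph α β)

/-- The Ising coupling `b ^ m` between two vertices joined by `m` parallel edges. -/
noncomputable def edgeCoupling (b : ℝ) (i j : V(G)) : ℝ :=
  b ^ {e | G.IsLink e i j}.ncard

lemma edgeCoupling_comm (b : ℝ) (i j : V(G)) : G.edgeCoupling b i j = G.edgeCoupling b j i := by
  simp only [edgeCoupling, G.isLink_comm]

lemma finite_setOf_isLink [Finite E(G)] (x y : α) : {e | G.IsLink e x y}.Finite :=
  (Set.toFinite E(G)).subset fun _ he => he.edge_mem

/-- Each disagreeing edge has exactly one ordered pair of ends (plus, minus), so the edge sets of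
these pairs are disjoint; self-loops never occur. -/
lemma disagreements_eq_sum [Fintype V(G)] [DecidableEq V(G)] [Finite E(G)] (σ : V(G) → Bool) :
    G.disagreements σ = ∑ i with σ i = true, ∑ j ∈ univ \ univ.filter (fun i => σ i = true),
      {e | G.IsLink e i j}.ncard := by
  classical
  have hU : {e | ∃ x y : V(G), G.IsLink e x y ∧ σ x ≠ σ y} =
      (((univ.filter fun i => σ i = true) ×ˢ (univ \ univ.filter fun i => σ i = true)).biUnion
        fun p => (G.finite_setOf_isLink p.1 p.2).toFinset : Finset β) := by
    ext e
    simp only [Set.mem_ofPred_eq, coe_biUnion, Set.mem_iUnion, mem_coe, mem_product, mem_sdiff,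
      mem_filter, mem_univ, true_and, Set.Finite.coe_toFinset, exists_prop, Prod.exists]
    constructor
    · rintro ⟨x, y, h, hxy⟩
      cases hx : σ x
      · exact ⟨y, x, ⟨by grind, by grind⟩, h.symm⟩
      · exact ⟨x, y, ⟨hx, by grind⟩, h⟩
    · rintro ⟨x, y, ⟨hx, hy⟩, h⟩
      exact ⟨x, y, h, by grind⟩
  rw [disagreements, hU, Set.ncard_coe_finset, card_biUnion, sum_product]
  · exact sum_congr rfl fun i _ => sum_congr rfl fun j _ =>
      (Set.ncard_eq_toFinset_card _ _).symm
  · rintro ⟨i, j⟩ hp ⟨i', j'⟩ hq hne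
    rw [mem_coe] at hp hq
    simp only [mem_product, mem_sdiff, mem_filter, mem_univ, true_and] at hp hq
    refine disjoint_left.2 fun e he he' => hne ?_
    rw [Set.Finite.mem_toFinset] at he he'
    rcases IsLink.eq_and_eq_or_eq_and_eq he he' with ⟨h1, h2⟩ | ⟨h1, h2⟩
    · exact Prod.ext (Subtype.ext h1) (Subtype.ext h2)
    · have h3 : i = j' := Subtype.ext h1
      exact absurd (h3 ▸ hp.1) hq.2

lemma pow_disagreements [Fintype V(G)] [DecidableEq V(G)] [Finite E(G)] (b : ℝ)
    (σ : V(G) → Bool) :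
    (b : ℂ) ^ G.disagreements σ = ∏ i with σ i = true, ∏ j ∈ univ \ univ.filter (fun i => σ i = true),
      (G.edgeCoupling b i j : ℂ) := by
  simp [disagreements_eq_sum, edgeCoupling, prod_pow_eq_pow_sum]

lemma exists_edgeCoupling_lt_one [Fintype V(G)] [Finite E(G)] (hG : G.Connected) {b : ℝ}
    (hb0 : 0 < b) (hb1 : b < 1) (T : Finset V(G)) (hT : T.Nonempty) (hT' : T ≠ univ) :
    ∃ i ∈ T, ∃ j ∉ T, G.edgeCoupling b i j < 1 := by
  obtain ⟨u, hu⟩ := hT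
  obtain ⟨v, hv⟩ : ∃ v, v ∉ T := by simpa [eq_univ_iff_forall] using hT'
  -- If no coupling leaving `T` is strict, no edge leaves `T`, so `T` contains everything reachable
  -- from `u`.
  by_contra! hcon
  have key : ∀ x, Relation.ReflTransGen G.Adj u x → ∀ hx : x ∈ V(G), (⟨x, hx⟩ : V(G)) ∈ T := by
    intro x h
    induction h with
    | refl => exact fun _ => hu
    | tail _ hadj ih =>
      intro hx
      by_contra hxT
      obtain ⟨e, he⟩ := hadj
      refine (hcon _ (ih he.left_mem) _ hxT).not_gt (pow_lt_one₀ hb0.le hb1 ?_)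
      exact (Set.ncard_pos (G.finite_setOf_isLink _ _)).2 ⟨e, he⟩ |>.ne'
  exact hv (key v (hG.2 u u.2 v v.2) v.2)

lemma isingPartition_eq_weighted [Fintype V(G)] (b : ℝ) :
    G.isingPartition b = G.weightedIsingPartition (fun _ => 1) b := by
  simp [isingPartition, weightedIsingPartition]

end Graph

lemma MvPolynomial.X_mul_pderiv_C_mul_prod_X_pow {σ R : Type*} [CommSemiring R] [DecidableEq σ]
    (s : Finset σ) (w : σ → ℕ) (a : R) (i : σ) :
    X i * pderiv i (C a * ∏ j ∈ s, X j ^ w j) =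
      (if i ∈ s then w i else 0) • (C a * ∏ j ∈ s, X j ^ w j) := by
  have h : C a * ∏ j ∈ s, X j ^ w j = monomial (∑ j ∈ s, Finsupp.single j (w j)) a := by
    rw [monomial_sum_index]
    simp_rw [X_pow_eq_monomial]
  rw [h, X_mul_pderiv_monomial, Finsupp.finsetSum_apply]
  simp [Finsupp.single_apply]

/-! ### The derivative as a weighted sum of plus parts -/

namespace Graph

variable {α β : Type*} (G : Graph α β)

lemma eval_activityDeriv_weightedIsingPartition [Fintype V(G)] [DecidableEq V(G)] [Finite E(G)]
    (w : V(G) → ℕ) (b : ℝ) (z : V(G) → ℂ) :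
    MvPolynomial.eval z (G.activityDeriv (G.weightedIsingPartition w b)) =
      ∑ v, (w v : ℂ) * plusPartition (G.edgeCoupling b) (fun i => z i ^ w i) v := by
  rw [activityDeriv, map_sum]
  refine sum_congr rfl fun v _ => ?_
  rw [plusPartition]
  have h := sum_powerset_insert_mem (G.edgeCoupling b) (notMem_erase v univ)
    (fun i => z i ^ w i) 1
  simp only [Pi.one_apply, mul_one] at h
  rw [← h, insert_erase (mem_univ v), weightedIsingPartition, map_sum, mul_sum, map_sum, mul_sum]
  refine sum_bij' (fun σ _ => univ.filter fun i => σ i = true) (fun T _ i => decide (i ∈ T))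
    (by simp) (by simp) (by simp) (by simp) fun σ _ => ?_
  rw [← pow_disagreements, MvPolynomial.X_mul_pderiv_C_mul_prod_X_pow]
  by_cases hv : σ v = true <;> simp [hv]

theorem eval_activityDeriv_ne_zero [Fintype V(G)] [Finite E(G)] (hG : G.Connected)
    {w : V(G) → ℕ} (hw : ∀ v, 0 < w v) {b : ℝ} (hb0 : 0 < b) (hb1 : b < 1) {z : V(G) → ℂ}
    (hz : ∀ v, 1 ≤ ‖z v‖) :
    MvPolynomial.eval z (G.activityDeriv (G.weightedIsingPartition w b)) ≠ 0 := by
  classical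
  have := hG.1.to_subtype
  rw [eval_activityDeriv_weightedIsingPartition]
  have := sum_mul_plusPartition_ne_zero (G.edgeCoupling_comm b) (fun _ _ => pow_pos hb0 _)
    (fun _ _ => pow_le_one₀ hb0.le hb1.le) (G.exists_edgeCoupling_lt_one hG hb0 hb1)
    (z := fun i => z i ^ w i) (fun i => by rw [norm_pow]; exact one_le_pow₀ (hz i))
    (w := fun i => w i) (fun i => by exact_mod_cast hw i)
  simpa using this

end Graph

end Ising

theorem theorem5 {α β : Type*} (G : Graph α β) [Fintype V(G)] [Finite E(G)]
    (hG : G.Connected) :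
    G.WeightedStrictGaussLucas ∧ G.StrictGaussLucas := by
  refine ⟨fun w hw b hb0 hb1 z hz => ?_, fun b hb0 hb1 z hz => ?_⟩
  · exact G.eval_activityDeriv_ne_zero hG (fun v => (hw v).1) hb0 hb1 hz
  · rw [G.isingPartition_eq_weighted]
    exact G.eval_activityDeriv_ne_zero hG (fun _ => one_pos) hb0 hb1 hz
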